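/- Let $c_1,c_2,c_3\ge 0$ and $\ell_1,\ell_2,\ell_3>0$ be real numbers with $\frac{c_1}{\ell_1}\le\frac{c_2}{\ell_2}\le\frac{c_3}{\ell_3}$, and let $$\mathcal P=\operatorname{conv}\{(f,x_1,x_2,x_3)\in\mathbb R^4 : f=x_1x_2x_3,\ x_i\in[c_i-\ell_i,c_i+\ell_i],\ i=1,2,3\}.$$ Then the 4-dimensional volume (Lebesgue measure) of $\mathcal P$ is $$\operatorname{vol}_4(\mathcal P)=\begin{cases} \frac83\ell_1^2\ell_2^2\ell_3^2\left(\frac{c_1}{\ell_1}+2\frac{c_2}{\ell_2}+2\frac{c_3}{\ell_3}\right), & \text{if } \frac{c_1}{\ell_1}\ge 1,\\ \frac83\ell_1^2\ell_2^2\ell_3^2\left(2\frac{c_2}{\ell_2}+2\frac{c_3}{\ell_3}+1\right), & \text{if } \frac{c_1}{\ell_1}<1 \text{ and } \frac{c_2}{\ell_2}\ge 1,\\ \frac83\ell_1^2\ell_2^2\ell_3^2\left(\frac{c_2}{\ell_2}+2\frac{c_3}{\ell_3}+2\right), & \text{if } \frac{c_2}{\ell_2}<1 \text{ and } \frac{c_3}{\ell_3}\ge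 1,\\ \frac83\ell_1^2\ell_2^2\ell_3^2\left(\frac{c_2}{\ell_2}+\frac{c_3}{\ell_3}+3\right), & \text{if } \frac{c_3}{\ell_3}<1,\ \frac{c_1}{\ell_1}+\frac{c_2}{\ell_2}+\frac{c_3}{\ell_3}\ge 1 \text{ and } \frac{c_2}{\ell_2}+\frac{c_3}{\ell_3}\ge 1+\frac{c_1}{\ell_1},\\ \frac43\ell_1^2\ell_2^2\ell_3^2\left(\frac{c_1}{\ell_1}+\frac{c_2}{\ell_2}+\frac{c_3}{\ell_3}+7\right), & \text{if } \frac{c_3}{\ell_3}<1,\ \frac{c_1}{\ell_1}+\frac{c_2}{\ell_2}+\frac{c_3}{\ell_3}\ge 1 \text{ and } \frac{c_2}{\ell_2}+\frac{c_3}{\ell_3}< 1+\frac{c_1}{\ell_1},\\ \frac{32}3\ell_1^2\ell_2^2\ell_3^2, & \text{if } \frac{c_3}{\ell_3}<1 \text{ and } \frac{c_1}{\ell_1}+\frac{c_2}{\ell_2}+\frac{c_3}{\ell_3}<1. \end{cases}$$ Moreover, the six cases form a partition of the set of all such parameters $(c_1,c_2,c_3,\ell_1,\ell_2,\ell_3)$: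 the six regions they define are nonempty and pairwise disjoint, and their union is the whole set. -/

import Mathlib

open MeasureTheory

noncomputable section

/-- The graph of the trilinear monomial over the box `∏ i, [c i - ℓ i, c i + ℓ i]`, as a set of
points `(f, x₁, x₂, x₃)` of `ℝ⁴`: coordinate `0` is the function value `f`, and coordinate
`i.succ` is the `i`-th variable (the variables `x₁, x₂, x₃` have the indices `0, 1, 2` of `Fin 3`). -/
def trilinearGraph (c ℓ : Fin 3 → ℝ) : Set (Fin 4 → ℝ) :=
  {p | p 0 = p 1 * p 2 * p 3 ∧ ∀ i : Fin 3, p i.succ ∈ Set.Icc (c i - ℓ i) (c i + ℓ i)}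

/-- The convex hull of the graph. -/
def trilinearHull (c ℓ : Fin 3 → ℝ) : Set (Fin 4 → ℝ) :=
  convexHull ℝ (trilinearGraph c ℓ)

/-- The admissible centers and half-lengths `(c, ℓ)`. -/
def parameterSpace : Set ((Fin 3 → ℝ) × (Fin 3 → ℝ)) :=
  {p | (∀ i, 0 ≤ p.1 i) ∧ (∀ i, 0 < p.2 i) ∧
    p.1 0 / p.2 0 ≤ p.1 1 / p.2 1 ∧ p.1 1 / p.2 1 ≤ p.1 2 / p.2 2}

/-- The conditions of the six cases. -/
def caseCondition (c ℓ : Fin 3 → ℝ) : Fin 6 → Prop :=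
  ![1 ≤ c 0 / ℓ 0,
    c 0 / ℓ 0 < 1 ∧ 1 ≤ c 1 / ℓ 1,
    c 1 / ℓ 1 < 1 ∧ 1 ≤ c 2 / ℓ 2,
    c 2 / ℓ 2 < 1 ∧ 1 ≤ c 0 / ℓ 0 + c 1 / ℓ 1 + c 2 / ℓ 2 ∧
      1 + c 0 / ℓ 0 ≤ c 1 / ℓ 1 + c 2 / ℓ 2,
    c 2 / ℓ 2 < 1 ∧ 1 ≤ c 0 / ℓ 0 + c 1 / ℓ 1 + c 2 / ℓ 2 ∧
      c 1 / ℓ 1 + c 2 / ℓ 2 < 1 + c 0 / ℓ 0,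
    c 2 / ℓ 2 < 1 ∧ c 0 / ℓ 0 + c 1 / ℓ 1 + c 2 / ℓ 2 < 1]

/-- The volume formulas of the six cases. -/
def caseVolume (c ℓ : Fin 3 → ℝ) : Fin 6 → ℝ :=
  ![8 / 3 * ℓ 0 ^ 2 * ℓ 1 ^ 2 * ℓ 2 ^ 2 * (c 0 / ℓ 0 + 2 * (c 1 / ℓ 1) + 2 * (c 2 / ℓ 2)),
    8 / 3 * ℓ 0 ^ 2 * ℓ 1 ^ 2 * ℓ 2 ^ 2 * (2 * (c 1 / ℓ 1) + 2 * (c 2 / ℓ 2) + 1),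
    8 / 3 * ℓ 0 ^ 2 * ℓ 1 ^ 2 * ℓ 2 ^ 2 * (c 1 / ℓ 1 + 2 * (c 2 / ℓ 2) + 2),
    8 / 3 * ℓ 0 ^ 2 * ℓ 1 ^ 2 * ℓ 2 ^ 2 * (c 1 / ℓ 1 + c 2 / ℓ 2 + 3),
    4 / 3 * ℓ 0 ^ 2 * ℓ 1 ^ 2 * ℓ 2 ^ 2 * (c 0 / ℓ 0 + c 1 / ℓ 1 + c 2 / ℓ 2 + 7),
    32 / 3 * ℓ 0 ^ 2 * ℓ 1 ^ 2 * ℓ 2 ^ 2]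

/-- The region of the parameter space where the `k`-th case applies. -/
def caseRegion (k : Fin 6) : Set ((Fin 3 → ℝ) × (Fin 3 → ℝ)) :=
  {p | p ∈ parameterSpace ∧ caseCondition p.1 p.2 k}

end

/-!
The ratios `a i = c i / ℓ i` decide everything: an affine change of coordinates turns the hull into
`cubeHull a`, the hull of the graph of `∏ i, (a i - 1 + 2 * u i)` over the unit cube. Its volume is
the integral over the cube of the difference of its upper and lower boundaries, that is, of the
concave and the convex envelope of this trilinear function. The reflection `u 0 ↦ 1 - u 0` changes
the sign of the function and of `a 0`, so the convex envelope for `a` is, up to sign, the concave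
envelope for `(-a 0, a 1, a 2)`, and only concave envelopes have to be found (`volume_cubeHull`).

The concave envelope is linear on the simplices of a triangulation of the cube that depends on `a`.
It is an affine function plus a nonnegative combination of the concave functions
`min (u j) (u k)`, `min (u 0) (min (u 1) (u 2))` and `-max λ 0`, where `λ` is the affine function
that is `1` at a vertex of the cube and `0` at its three neighbours (`piecewiseLinear`). Such a
function with the right values at the vertices lies above the trilinear function, because each of
the basis functions lies above the trilinear function with its own vertex values. It is the envelope
if, moreover, its graph is contained in the hull. For this it is enough to interpolate the products
`u 1 * u 2`, `u 0 * u 2`, `u 0 * u 1` and `u 0 * u 1 * u 2` so that the eight vertex weights which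
they determine stay nonnegative (`cons_mem_cubeHull`). Three types of envelopes occur:
`isUpperEnvelope_of_diagonal`, `isUpperEnvelope_of_tetrahedron` and
`isUpperEnvelope_of_opposite_corners`.

The integrals of the basis functions over the cube are `1 / 3`, `1 / 4` and `1 / 24`, so that the
volume in each case is a sum of two values of one linear formula (`integral_piecewiseLinear`).
-/

/-! ### Integrals over the unit cube -/

theorem integral_cube_eq_iterated (F : (Fin 3 → ℝ) → ℝ) (hF : Continuous F) :
    ∫ u in Set.Icc (0 : Fin 3 → ℝ) 1, F u =
      ∫ x in (0 : ℝ)..1, ∫ y in (0 : ℝ)..1, ∫ z in (0 : ℝ)..1, F ![x, y, z] := by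
  let e : (Fin 3 → ℝ) ≃ᵐ ℝ × ℝ × ℝ :=
    (MeasurableEquiv.piFinSuccAbove (fun _ => ℝ) 0).trans
      ((MeasurableEquiv.refl ℝ).prodCongr (MeasurableEquiv.piFinTwo fun _ => ℝ))
  have he : MeasurePreserving e volume volume :=
    (volume_preserving_piFinSuccAbove (fun _ : Fin 3 => ℝ) 0).trans
      ((MeasurePreserving.id volume).prod (volume_preserving_piFinTwo fun _ => ℝ))
  have hs : Set.Icc (0 : Fin 3 → ℝ) 1 =
      e ⁻¹' (Set.Icc (0 : ℝ) 1 ×ˢ (Set.Icc (0 : ℝ) 1 ×ˢ Set.Icc (0 : ℝ) 1)) := by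
    ext u
    have h : e u = (u 0, u 1, u 2) := rfl
    simp only [Set.mem_preimage, h, Set.mem_prod, Set.mem_Icc, Pi.le_def, Fin.forall_fin_succ,
      Pi.zero_apply, Pi.one_apply, Fin.succ_zero_eq_one, Fin.succ_one_eq_two, IsEmpty.forall_iff]
    tauto
  have hg : ∀ u, F u = (fun p : ℝ × ℝ × ℝ => F ![p.1, p.2.1, p.2.2]) (e u) := by
    intro u
    have h : e u = (u 0, u 1, u 2) := rfl
    simp only [h]
    congr 1
    ext i
    fin_cases i <;> rfl
  have hc : Continuous fun p : ℝ × ℝ × ℝ => F ![p.1, p.2.1, p.2.2] := by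
    refine hF.comp (continuous_pi fun i => ?_)
    fin_cases i
    exacts [continuous_fst, continuous_snd.fst, continuous_snd.snd]
  have hk : IsCompact (Set.Icc (0 : ℝ) 1 ×ˢ Set.Icc (0 : ℝ) 1) := isCompact_Icc.prod isCompact_Icc
  rw [setIntegral_congr_fun measurableSet_Icc (fun u _ => hg u), hs,
    he.setIntegral_preimage_emb e.measurableEmbedding
      (fun p : ℝ × ℝ × ℝ => F ![p.1, p.2.1, p.2.2]), Measure.volume_eq_prod,
    setIntegral_prod _ (hc.continuousOn.integrableOn_compact (isCompact_Icc.prod hk)),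
    intervalIntegral.integral_of_le zero_le_one, integral_Icc_eq_integral_Ioc]
  refine setIntegral_congr_fun measurableSet_Ioc fun x _ => ?_
  have hcx : Continuous fun p : ℝ × ℝ => F ![x, p.1, p.2] :=
    hc.comp (Continuous.prodMk_right x)
  simp only
  rw [Measure.volume_eq_prod, setIntegral_prod _ (hcx.continuousOn.integrableOn_compact hk),
    intervalIntegral.integral_of_le zero_le_one, integral_Icc_eq_integral_Ioc]
  refine setIntegral_congr_fun measurableSet_Ioc fun y _ => ?_
  simp only
  rw [intervalIntegral.integral_of_le zero_le_one, integral_Icc_eq_integral_Ioc]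

theorem integral_posPart_pow {s : ℝ} (hs : s ≤ 1) {n : ℕ} (hn : n ≠ 0) :
    ∫ x in (0 : ℝ)..1, max (s - x) 0 ^ n = max s 0 ^ (n + 1) / (n + 1) := by
  rcases le_total s 0 with h | h
  · rw [max_eq_right h, intervalIntegral.integral_congr (g := fun _ => (0 : ℝ))]
    · simp
    · intro x hx
      rw [Set.uIcc_of_le zero_le_one] at hx
      simp only
      rw [max_eq_right (by linarith [hx.1]), zero_pow hn]
  · have hc : Continuous fun x : ℝ => max (s - x) 0 ^ n := by fun_prop
    rw [max_eq_left h, ← intervalIntegral.integral_add_adjacent_intervals (b := s)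
      (hc.intervalIntegrable _ _) (hc.intervalIntegrable _ _),
      intervalIntegral.integral_congr (g := fun x => (s - x) ^ n),
      intervalIntegral.integral_congr (a := s) (g := fun _ => (0 : ℝ))]
    · rw [intervalIntegral.integral_comp_sub_left (fun x => x ^ n)]
      simp
    · intro x hx
      rw [Set.uIcc_of_le hs] at hx
      simp only
      rw [max_eq_right (by linarith [hx.1]), zero_pow hn]
    · intro x hx
      rw [Set.uIcc_of_le h] at hx
      simp only
      rw [max_eq_left (by linarith [hx.2])]

/-- The tetrahedron cut off from the unit cube at the origin has volume `1 / 6`, and the integrand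
runs over it linearly from `1` at the origin to `0` at the other three vertices. -/
theorem iterated_integral_corner :
    ∫ x in (0 : ℝ)..1, ∫ y in (0 : ℝ)..1, ∫ z in (0 : ℝ)..1, max (1 - x - y - z) 0 = 1 / 24 := by
  calc _ = ∫ x in (0 : ℝ)..1, max (1 - x) 0 ^ 3 / 6 := by
        refine intervalIntegral.integral_congr fun x hx => ?_
        rw [Set.uIcc_of_le zero_le_one] at hx
        calc _ = ∫ y in (0 : ℝ)..1, max (1 - x - y) 0 ^ 2 / 2 := by
              refine intervalIntegral.integral_congr fun y hy => ?_
              rw [Set.uIcc_of_le zero_le_one] at hy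
              have := integral_posPart_pow (s := 1 - x - y) (by linarith [hx.1, hy.1]) one_ne_zero
              simp only [pow_one] at this
              simp only [this]
              norm_num
          _ = _ := by
              rw [intervalIntegral.integral_div,
                integral_posPart_pow (s := 1 - x) (by linarith [hx.1]) two_ne_zero]
              norm_num
              ring
    _ = _ := by
        rw [intervalIntegral.integral_div, integral_posPart_pow le_rfl three_ne_zero]
        norm_num

theorem iterated_integral_min_min :
    ∫ x in (0 : ℝ)..1, ∫ y in (0 : ℝ)..1, ∫ z in (0 : ℝ)..1, min x (min y z) = 1 / 4 := by
  have hz : ∀ s ∈ Set.Icc (0 : ℝ) 1, ∫ z in (0 : ℝ)..1, min s z = s - s ^ 2 / 2 := by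
    intro s hs
    have h : ∀ z : ℝ, min s z = s - max (s - z) 0 ^ 1 := fun z => by
      rcases le_total s z with h | h <;> simp [h]
    simp_rw [h]
    rw [intervalIntegral.integral_sub (by simp)
      (Continuous.intervalIntegrable (by fun_prop) _ _), integral_posPart_pow hs.2 one_ne_zero,
      max_eq_left hs.1]
    norm_num
  have hy : ∀ s ∈ Set.Icc (0 : ℝ) 1,
      ∫ z in (0 : ℝ)..1, (min s z) ^ 2 = s ^ 2 - 2 / 3 * s ^ 3 := by
    intro s hs
    have h : ∀ z : ℝ, min s z ^ 2 = s ^ 2 - 2 * s * max (s - z) 0 ^ 1 + max (s - z) 0 ^ 2 :=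
      fun z => by
        rcases le_total s z with h | h
        · simp [h]
        · simp [h]; ring
    simp_rw [h]
    rw [intervalIntegral.integral_add (Continuous.intervalIntegrable (by fun_prop) _ _)
      (Continuous.intervalIntegrable (by fun_prop) _ _), intervalIntegral.integral_sub (by simp)
      (Continuous.intervalIntegrable (by fun_prop) _ _), intervalIntegral.integral_const_mul,
      integral_posPart_pow hs.2 one_ne_zero, integral_posPart_pow hs.2 two_ne_zero,
      max_eq_left hs.1]
    norm_num
    ring
  calc _ = ∫ x in (0 : ℝ)..1, (x - x ^ 2 + x ^ 3 / 3) := by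
        refine intervalIntegral.integral_congr fun x hx => ?_
        rw [Set.uIcc_of_le zero_le_one] at hx
        calc _ = ∫ y in (0 : ℝ)..1, (min x y - min x y ^ 2 / 2) := by
              refine intervalIntegral.integral_congr fun y hy => ?_
              rw [Set.uIcc_of_le zero_le_one] at hy
              simp only [← min_assoc]
              exact hz _ ⟨le_min hx.1 hy.1, min_le_of_left_le hx.2⟩
          _ = _ := by
              rw [intervalIntegral.integral_sub (Continuous.intervalIntegrable (by fun_prop) _ _)
                (Continuous.intervalIntegrable (by fun_prop) _ _), intervalIntegral.integral_div,
                hz x hx, hy x hx]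
              ring
    _ = _ := by
        rw [intervalIntegral.integral_add (Continuous.intervalIntegrable (by fun_prop) _ _)
          (Continuous.intervalIntegrable (by fun_prop) _ _), intervalIntegral.integral_sub
          (Continuous.intervalIntegrable (by fun_prop) _ _)
          (Continuous.intervalIntegrable (by fun_prop) _ _)]
        simp only [intervalIntegral.integral_div, integral_id, integral_pow]
        norm_num

theorem iterated_integral_min :
    ∫ x in (0 : ℝ)..1, ∫ y in (0 : ℝ)..1, min x y = 1 / 3 := by
  calc _ = ∫ x in (0 : ℝ)..1, (x - x ^ 2 / 2) := by
        refine intervalIntegral.integral_congr fun s hx => ?_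
        rw [Set.uIcc_of_le zero_le_one] at hx
        have h : ∀ z : ℝ, min s z = s - max (s - z) 0 ^ 1 := fun z => by
          rcases le_total s z with h | h <;> simp [h]
        simp_rw [h]
        rw [intervalIntegral.integral_sub (by simp)
          (Continuous.intervalIntegrable (by fun_prop) _ _), integral_posPart_pow hx.2 one_ne_zero,
          max_eq_left hx.1]
        norm_num
    _ = _ := by
        rw [intervalIntegral.integral_sub
          (Continuous.intervalIntegrable (by fun_prop) _ _)
          (Continuous.intervalIntegrable (by fun_prop) _ _)]
        simp only [intervalIntegral.integral_div, integral_id, integral_pow]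
        norm_num

theorem integral_zero_one_comp_one_sub (f : ℝ → ℝ) :
    ∫ x in (0 : ℝ)..1, f (1 - x) = ∫ x in (0 : ℝ)..1, f x := by
  simp [intervalIntegral.integral_comp_sub_left f 1]

/-! ### Piecewise linear functions on the unit cube -/

/-- The piecewise linear functions that occur as concave envelopes of trilinear functions on the
unit cube: an affine function (constant term `r₀`, slopes `r`), plus multiples of the minima of two
coordinates (`m i` belongs to the pair without `i`) and of all three, minus multiples of the
functions that are `1` at one vertex of the cube, `0` at all the others, and linear on the
tetrahedron cut off by the three neighbours of that vertex. These are the vertices with `u i = 0`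
and the other coordinates `1` (coefficient `q i`), the origin (coefficient `q'`), and the unit
vector `(1, 0, 0)` (coefficient `q''`). -/
noncomputable def piecewiseLinear (r₀ : ℝ) (r m : Fin 3 → ℝ) (n : ℝ) (q : Fin 3 → ℝ) (q' q'' : ℝ)
    (u : Fin 3 → ℝ) : ℝ :=
  r₀ + (r 0 * u 0 + r 1 * u 1 + r 2 * u 2)
    + (m 0 * min (u 1) (u 2) + m 1 * min (u 0) (u 2) + m 2 * min (u 0) (u 1))
    + n * min (u 0) (min (u 1) (u 2))
    - (q 0 * max (u 1 + u 2 - u 0 - 1) 0 + q 1 * max (u 0 + u 2 - u 1 - 1) 0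
      + q 2 * max (u 0 + u 1 - u 2 - 1) 0)
    - q' * max (1 - u 0 - u 1 - u 2) 0 - q'' * max (u 0 - u 1 - u 2) 0

section
variable (r₀ : ℝ) (r m : Fin 3 → ℝ) (n : ℝ) (q : Fin 3 → ℝ) (q' q'' : ℝ)

theorem continuous_piecewiseLinear : Continuous (piecewiseLinear r₀ r m n q q' q'') := by
  unfold piecewiseLinear
  fun_prop

theorem integral_piecewiseLinear :
    ∫ u in Set.Icc (0 : Fin 3 → ℝ) 1, piecewiseLinear r₀ r m n q q' q'' u =
      r₀ + (r 0 + r 1 + r 2) / 2 + (m 0 + m 1 + m 2) / 3 + n / 4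
        - (q 0 + q 1 + q 2 + q' + q'') / 24 := by
  have hint : ∀ F : (Fin 3 → ℝ) → ℝ, Continuous F →
      IntegrableOn F (Set.Icc (0 : Fin 3 → ℝ) 1) volume :=
    fun F hF => hF.continuousOn.integrableOn_compact isCompact_Icc
  have hu0 : ∫ u in Set.Icc (0 : Fin 3 → ℝ) 1, u 0 = 1 / 2 := by
    rw [integral_cube_eq_iterated _ (by fun_prop)]; simp
  have hu1 : ∫ u in Set.Icc (0 : Fin 3 → ℝ) 1, u 1 = 1 / 2 := by
    rw [integral_cube_eq_iterated _ (by fun_prop)]; simp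
  have hu2 : ∫ u in Set.Icc (0 : Fin 3 → ℝ) 1, u 2 = 1 / 2 := by
    rw [integral_cube_eq_iterated _ (by fun_prop)]; simp
  have hm0 : ∫ u in Set.Icc (0 : Fin 3 → ℝ) 1, min (u 1) (u 2) = 1 / 3 := by
    rw [integral_cube_eq_iterated _ (by fun_prop)]
    simpa using iterated_integral_min
  have hm1 : ∫ u in Set.Icc (0 : Fin 3 → ℝ) 1, min (u 0) (u 2) = 1 / 3 := by
    rw [integral_cube_eq_iterated _ (by fun_prop)]
    simpa using iterated_integral_min
  have hm2 : ∫ u in Set.Icc (0 : Fin 3 → ℝ) 1, min (u 0) (u 1) = 1 / 3 := by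
    rw [integral_cube_eq_iterated _ (by fun_prop)]
    simpa using iterated_integral_min
  have hn : ∫ u in Set.Icc (0 : Fin 3 → ℝ) 1, min (u 0) (min (u 1) (u 2)) = 1 / 4 := by
    rw [integral_cube_eq_iterated _ (by fun_prop)]
    simpa using iterated_integral_min_min
  have hq' : ∫ u in Set.Icc (0 : Fin 3 → ℝ) 1, max (1 - u 0 - u 1 - u 2) 0 = 1 / 24 := by
    rw [integral_cube_eq_iterated _ (by fun_prop)]
    simpa using iterated_integral_corner
  -- The other corners are mirror images of the corner at the origin.
  have hq0 : ∫ u in Set.Icc (0 : Fin 3 → ℝ) 1, max (u 1 + u 2 - u 0 - 1) 0 = 1 / 24 := by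
    rw [integral_cube_eq_iterated _ (by fun_prop), ← iterated_integral_corner]
    congr! 2 with x
    rw [← integral_zero_one_comp_one_sub]
    congr! 2 with y
    rw [← integral_zero_one_comp_one_sub]
    congr! 2 with z
    simp only [Matrix.cons_val]
    congr 1; ring
  have hq1 : ∫ u in Set.Icc (0 : Fin 3 → ℝ) 1, max (u 0 + u 2 - u 1 - 1) 0 = 1 / 24 := by
    rw [integral_cube_eq_iterated _ (by fun_prop), ← iterated_integral_corner,
      ← integral_zero_one_comp_one_sub]
    congr! 2 with x
    congr! 2 with y
    rw [← integral_zero_one_comp_one_sub]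
    congr! 2 with z
    simp only [Matrix.cons_val]
    congr 1; ring
  have hq2 : ∫ u in Set.Icc (0 : Fin 3 → ℝ) 1, max (u 0 + u 1 - u 2 - 1) 0 = 1 / 24 := by
    rw [integral_cube_eq_iterated _ (by fun_prop), ← iterated_integral_corner,
      ← integral_zero_one_comp_one_sub]
    congr! 2 with x
    rw [← integral_zero_one_comp_one_sub]
    congr! 4 with y z
    simp only [Matrix.cons_val]
    congr 1; ring
  have hq'' : ∫ u in Set.Icc (0 : Fin 3 → ℝ) 1, max (u 0 - u 1 - u 2) 0 = 1 / 24 := by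
    rw [integral_cube_eq_iterated _ (by fun_prop), ← iterated_integral_corner,
      ← integral_zero_one_comp_one_sub]
    congr! 6 with x y z
  have hr₀ : ∫ u in Set.Icc (0 : Fin 3 → ℝ) 1, r₀ = r₀ := by
    rw [integral_cube_eq_iterated _ (by fun_prop)]; simp
  unfold piecewiseLinear
  rw [integral_sub (hint _ (by fun_prop)) (hint _ (by fun_prop)),
    integral_sub (hint _ (by fun_prop)) (hint _ (by fun_prop)),
    integral_sub (hint _ (by fun_prop)) (hint _ (by fun_prop)),
    integral_add (hint _ (by fun_prop)) (hint _ (by fun_prop)),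
    integral_add (hint _ (by fun_prop)) (hint _ (by fun_prop)),
    integral_add (hint _ (by fun_prop)) (hint _ (by fun_prop)),
    integral_add (hint _ (by fun_prop)) (hint _ (by fun_prop)),
    integral_add (hint _ (by fun_prop)) (hint _ (by fun_prop)),
    integral_add (hint _ (by fun_prop)) (hint _ (by fun_prop)),
    integral_add (hint _ (by fun_prop)) (hint _ (by fun_prop)),
    integral_add (hint _ (by fun_prop)) (hint _ (by fun_prop)),
    integral_add (hint _ (by fun_prop)) (hint _ (by fun_prop))]
  simp only [integral_const_mul, hr₀, hu0, hu1, hu2, hm0, hm1, hm2, hn, hq0, hq1, hq2, hq', hq'']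
  ring

theorem concaveOn_piecewiseLinear (hm : ∀ i, 0 ≤ m i) (hn : 0 ≤ n) (hq : ∀ i, 0 ≤ q i)
    (hq' : 0 ≤ q') (hq'' : 0 ≤ q'') :
    ConcaveOn ℝ Set.univ (piecewiseLinear r₀ r m n q q' q'') := by
  have hc : ∀ i, ConcaveOn ℝ Set.univ fun u : Fin 3 → ℝ => u i :=
    fun i => (LinearMap.proj i : (Fin 3 → ℝ) →ₗ[ℝ] ℝ).concaveOn convex_univ
  have hv : ∀ i, ConvexOn ℝ Set.univ fun u : Fin 3 → ℝ => u i :=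
    fun i => (LinearMap.proj i : (Fin 3 → ℝ) →ₗ[ℝ] ℝ).convexOn convex_univ
  have h0 := convexOn_const (𝕜 := ℝ) (0 : ℝ) (convex_univ (E := Fin 3 → ℝ))
  have h1 := concaveOn_const (𝕜 := ℝ) (1 : ℝ) (convex_univ (E := Fin 3 → ℝ))
  have h1' := convexOn_const (𝕜 := ℝ) (1 : ℝ) (convex_univ (E := Fin 3 → ℝ))
  have hlin : ConcaveOn ℝ Set.univ fun u : Fin 3 → ℝ =>
      r₀ + (r 0 * u 0 + r 1 * u 1 + r 2 * u 2) :=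
    ⟨convex_univ, fun x _ y _ a b _ _ hab => by
      obtain rfl : b = 1 - a := by linarith
      simp only [smul_eq_mul, Pi.add_apply, Pi.smul_apply]
      apply le_of_eq; ring⟩
  unfold piecewiseLinear
  exact ((((hlin.add
    (((((hc 1).inf (hc 2)).smul (hm 0)).add (((hc 0).inf (hc 2)).smul (hm 1))).add
      (((hc 0).inf (hc 1)).smul (hm 2)))).add
    (((hc 0).inf ((hc 1).inf (hc 2))).smul hn)).sub
    (((((((hv 1).add (hv 2)).sub (hc 0)).sub h1).sup h0).smul (hq 0)).add
      ((((((hv 0).add (hv 2)).sub (hc 1)).sub h1).sup h0).smul (hq 1)) |>.add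
      ((((((hv 0).add (hv 1)).sub (hc 2)).sub h1).sup h0).smul (hq 2)))).sub
    (((((h1'.sub (hc 0)).sub (hc 1)).sub (hc 2)).sup h0).smul hq')).sub
    (((((hv 0).sub (hc 1)).sub (hc 2)).sup h0).smul hq'')

/-- On the cube, each basis function of `piecewiseLinear` with its sign lies above the trilinear
function with the same values at the vertices. -/
theorem trilinear_le_piecewiseLinear (hm : ∀ i, 0 ≤ m i) (hn : 0 ≤ n) (hq : ∀ i, 0 ≤ q i)
    (hq' : 0 ≤ q') (hq'' : 0 ≤ q'') {u : Fin 3 → ℝ} (hu : ∀ i, u i ∈ Set.Icc (0 : ℝ) 1) :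
    r₀ + (r 0 * u 0 + r 1 * u 1 + r 2 * u 2)
      + (m 0 * (u 1 * u 2) + m 1 * (u 0 * u 2) + m 2 * (u 0 * u 1)) + n * (u 0 * (u 1 * u 2))
      - (q 0 * ((1 - u 0) * u 1 * u 2) + q 1 * (u 0 * (1 - u 1) * u 2)
        + q 2 * (u 0 * u 1 * (1 - u 2)))
      - q' * ((1 - u 0) * (1 - u 1) * (1 - u 2)) - q'' * (u 0 * (1 - u 1) * (1 - u 2)) ≤
    piecewiseLinear r₀ r m n q q' q'' u := by
  have hmin : ∀ x ∈ Set.Icc (0 : ℝ) 1, ∀ y ∈ Set.Icc (0 : ℝ) 1, x * y ≤ min x y :=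
    fun x hx y hy => le_min (mul_le_of_le_one_right hx.1 hy.2) (mul_le_of_le_one_left hy.1 hx.2)
  have hcorner : ∀ x ∈ Set.Icc (0 : ℝ) 1, ∀ y ∈ Set.Icc (0 : ℝ) 1, ∀ z ∈ Set.Icc (0 : ℝ) 1,
      max (1 - x - y - z) 0 ≤ (1 - x) * (1 - y) * (1 - z) := by
    intro x hx y hy z hz
    have h1 := mul_nonneg hx.1 hy.1
    have h2 := mul_nonneg (sub_nonneg.2 hx.2) (sub_nonneg.2 hy.2)
    refine max_le ?_ (mul_nonneg h2 (sub_nonneg.2 hz.2))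
    have h3 : (1 - x) * (1 - y) ≤ 1 := by nlinarith [hx.1, hy.1, hx.2, hy.2]
    linarith [mul_le_of_le_one_left hz.1 h3]
  have hflip : ∀ i, 1 - u i ∈ Set.Icc (0 : ℝ) 1 :=
    fun i => ⟨by linarith [(hu i).2], by linarith [(hu i).1]⟩
  have e0 := hcorner _ (hu 0) _ (hflip 1) _ (hflip 2)
  have e1 := hcorner _ (hflip 0) _ (hu 1) _ (hflip 2)
  have e2 := hcorner _ (hflip 0) _ (hflip 1) _ (hu 2)
  have e' := hcorner _ (hu 0) _ (hu 1) _ (hu 2)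
  have e'' := hcorner _ (hflip 0) _ (hu 1) _ (hu 2)
  rw [show 1 - u 0 - (1 - u 1) - (1 - u 2) = u 1 + u 2 - u 0 - 1 by ring,
    sub_sub_cancel, sub_sub_cancel] at e0
  rw [show 1 - (1 - u 0) - u 1 - (1 - u 2) = u 0 + u 2 - u 1 - 1 by ring,
    sub_sub_cancel, sub_sub_cancel] at e1
  rw [show 1 - (1 - u 0) - (1 - u 1) - u 2 = u 0 + u 1 - u 2 - 1 by ring,
    sub_sub_cancel, sub_sub_cancel] at e2
  rw [sub_sub_cancel] at e''
  have hm12 := hmin _ (hu 1) _ (hu 2)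
  have hn' : u 0 * (u 1 * u 2) ≤ min (u 0) (min (u 1) (u 2)) :=
    (hmin _ (hu 0) _ ⟨mul_nonneg (hu 1).1 (hu 2).1, mul_le_one₀ (hu 1).2 (hu 2).1 (hu 2).2⟩).trans
      (min_le_min le_rfl hm12)
  unfold piecewiseLinear
  gcongr
  · exact hm 0
  · exact hm 1
  · exact hmin _ (hu 0) _ (hu 2)
  · exact hm 2
  · exact hmin _ (hu 0) _ (hu 1)
  · exact hq 0
  · exact hq 1
  · exact hq 2

end

/-! ### Concave envelopes of trilinear functions on the unit cube -/

/-- The graph of `u ↦ ∏ i, (a i - 1 + 2 * u i)` over the unit cube. With `a i = c i / ℓ i`, this is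
`trilinearGraph c ℓ` up to a translation and a scaling of the coordinates. -/
def cubeGraph (a : Fin 3 → ℝ) : Set (Fin 4 → ℝ) :=
  {p | p 0 = (a 0 - 1 + 2 * p 1) * (a 1 - 1 + 2 * p 2) * (a 2 - 1 + 2 * p 3) ∧
    ∀ i : Fin 3, p i.succ ∈ Set.Icc (0 : ℝ) 1}

/-- The convex hull of `cubeGraph a`. -/
def cubeHull (a : Fin 3 → ℝ) : Set (Fin 4 → ℝ) :=
  convexHull ℝ (cubeGraph a)

/-- `U` is continuous and is the upper boundary of `cubeHull a` over the unit cube. -/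
structure IsUpperEnvelope (a : Fin 3 → ℝ) (U : (Fin 3 → ℝ) → ℝ) : Prop where
  continuous : Continuous U
  le : ∀ p ∈ cubeHull a, p 0 ≤ U (Fin.tail p)
  mem : ∀ u : Fin 3 → ℝ, (∀ i, u i ∈ Set.Icc (0 : ℝ) 1) →
    (Fin.cons (U u) u : Fin 4 → ℝ) ∈ cubeHull a

theorem tail_mem_Icc_of_mem_cubeHull {a : Fin 3 → ℝ} {p : Fin 4 → ℝ} (hp : p ∈ cubeHull a)
    (i : Fin 3) : p i.succ ∈ Set.Icc (0 : ℝ) 1 := by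
  have h : Convex ℝ {p : Fin 4 → ℝ | p i.succ ∈ Set.Icc (0 : ℝ) 1} :=
    (convex_Icc (0 : ℝ) 1).linear_preimage (LinearMap.proj i.succ : (Fin 4 → ℝ) →ₗ[ℝ] ℝ)
  exact convexHull_min (fun q hq => hq.2 i) h hp

/-- A point over the cube lies in the hull as soon as its height arises from the trilinear function
by replacing each product `u j * u k` by a number `b i` and `u 0 * u 1 * u 2` by `t`, provided the
eight numbers that Möbius inversion makes of them are nonnegative: these are then the weights of the
vertices in a convex combination. -/
theorem cons_mem_cubeHull (a u : Fin 3 → ℝ) (b₀ b₁ b₂ t : ℝ)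
    (h₀₁₂ : 0 ≤ t) (h₁₂ : 0 ≤ b₀ - t) (h₀₂ : 0 ≤ b₁ - t) (h₀₁ : 0 ≤ b₂ - t)
    (h₀ : 0 ≤ u 0 - b₁ - b₂ + t) (h₁ : 0 ≤ u 1 - b₀ - b₂ + t) (h₂ : 0 ≤ u 2 - b₀ - b₁ + t)
    (h : 0 ≤ 1 - u 0 - u 1 - u 2 + b₀ + b₁ + b₂ - t) :
    (Fin.cons ((a 0 - 1) * (a 1 - 1) * (a 2 - 1)
      + 2 * ((a 1 - 1) * (a 2 - 1) * u 0 + (a 0 - 1) * (a 2 - 1) * u 1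
        + (a 0 - 1) * (a 1 - 1) * u 2)
      + 4 * ((a 0 - 1) * b₀ + (a 1 - 1) * b₁ + (a 2 - 1) * b₂) + 8 * t) u : Fin 4 → ℝ)
      ∈ cubeHull a := by
  let v : Fin 8 → Fin 3 → ℝ := ![![1, 1, 1], ![0, 1, 1], ![1, 0, 1], ![1, 1, 0],
    ![1, 0, 0], ![0, 1, 0], ![0, 0, 1], ![0, 0, 0]]
  let w : Fin 8 → ℝ := ![t, b₀ - t, b₁ - t, b₂ - t, u 0 - b₁ - b₂ + t, u 1 - b₀ - b₂ + t,
    u 2 - b₀ - b₁ + t, 1 - u 0 - u 1 - u 2 + b₀ + b₁ + b₂ - t]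
  let z : Fin 8 → Fin 4 → ℝ := fun k =>
    ![(a 0 - 1 + 2 * v k 0) * (a 1 - 1 + 2 * v k 1) * (a 2 - 1 + 2 * v k 2), v k 0, v k 1, v k 2]
  have hw : ∀ k ∈ Finset.univ, 0 ≤ w k := by
    simp only [Finset.mem_univ, true_imp_iff, Fin.forall_fin_succ]
    exact ⟨h₀₁₂, h₁₂, h₀₂, h₀₁, h₀, h₁, h₂, h, fun i => i.elim0⟩
  have hsum : ∑ k, w k = 1 := by
    simp only [w, Fin.sum_univ_eight, Matrix.cons_val]
    ring
  have hz : ∀ k ∈ Finset.univ, z k ∈ cubeHull a := by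
    intro k _
    refine subset_convexHull ℝ _ ⟨rfl, fun i => ?_⟩
    have hv : ∀ k i, v k i ∈ Set.Icc (0 : ℝ) 1 := by
      intro k i
      fin_cases k <;> fin_cases i <;> simp [v]
    fin_cases i
    exacts [hv k 0, hv k 1, hv k 2]
  have hmem : ∑ k, w k • z k ∈ cubeHull a :=
    (convex_convexHull ℝ (cubeGraph a)).sum_mem hw hsum hz
  convert hmem using 1
  ext i
  rw [Finset.sum_apply]
  fin_cases i <;>
    simp only [z, v, w, Fin.sum_univ_eight, Pi.smul_apply, smul_eq_mul, Matrix.cons_val,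
      Fin.zero_eta, Fin.mk_one, Fin.reduceFinMk, Fin.cons_zero]
  · ring
  · change u 0 = _
    ring
  · change u 1 = _
    ring
  · change u 2 = _
    ring

/-- A concave piecewise linear function with the values of the trilinear function at the vertices
of the cube is its concave envelope, if at each point it is an interpolation as in
`cons_mem_cubeHull`. -/
theorem isUpperEnvelope_piecewiseLinear {a : Fin 3 → ℝ} {r₀ : ℝ} {r m : Fin 3 → ℝ} {n : ℝ}
    {q : Fin 3 → ℝ} {q' q'' : ℝ} (hm : ∀ i, 0 ≤ m i) (hn : 0 ≤ n) (hq : ∀ i, 0 ≤ q i)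
    (hq' : 0 ≤ q') (hq'' : 0 ≤ q'')
    (heq : ∀ u : Fin 3 → ℝ, (a 0 - 1 + 2 * u 0) * (a 1 - 1 + 2 * u 1) * (a 2 - 1 + 2 * u 2) =
      r₀ + (r 0 * u 0 + r 1 * u 1 + r 2 * u 2)
      + (m 0 * (u 1 * u 2) + m 1 * (u 0 * u 2) + m 2 * (u 0 * u 1)) + n * (u 0 * (u 1 * u 2))
      - (q 0 * ((1 - u 0) * u 1 * u 2) + q 1 * (u 0 * (1 - u 1) * u 2)
        + q 2 * (u 0 * u 1 * (1 - u 2)))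
      - q' * ((1 - u 0) * (1 - u 1) * (1 - u 2)) - q'' * (u 0 * (1 - u 1) * (1 - u 2)))
    (hb : ∀ u : Fin 3 → ℝ, (∀ i, u i ∈ Set.Icc (0 : ℝ) 1) → ∃ b₀ b₁ b₂ t : ℝ,
      0 ≤ t ∧ 0 ≤ b₀ - t ∧ 0 ≤ b₁ - t ∧ 0 ≤ b₂ - t ∧
      0 ≤ u 0 - b₁ - b₂ + t ∧ 0 ≤ u 1 - b₀ - b₂ + t ∧ 0 ≤ u 2 - b₀ - b₁ + t ∧
      0 ≤ 1 - u 0 - u 1 - u 2 + b₀ + b₁ + b₂ - t ∧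
      piecewiseLinear r₀ r m n q q' q'' u = (a 0 - 1) * (a 1 - 1) * (a 2 - 1)
      + 2 * ((a 1 - 1) * (a 2 - 1) * u 0 + (a 0 - 1) * (a 2 - 1) * u 1
        + (a 0 - 1) * (a 1 - 1) * u 2)
      + 4 * ((a 0 - 1) * b₀ + (a 1 - 1) * b₁ + (a 2 - 1) * b₂) + 8 * t) :
    IsUpperEnvelope a (piecewiseLinear r₀ r m n q q' q'') where
  continuous := continuous_piecewiseLinear ..
  le p hp := by
    have hcv := concaveOn_piecewiseLinear r₀ r m n q q' q'' hm hn hq hq' hq''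
    have h : Convex ℝ {p : Fin 4 → ℝ | p 0 ≤ piecewiseLinear r₀ r m n q q' q'' (Fin.tail p)} := by
      intro x hx y hy s t hs ht hst
      exact (add_le_add (mul_le_mul_of_nonneg_left hx hs) (mul_le_mul_of_nonneg_left hy ht)).trans
        (hcv.2 (Set.mem_univ (Fin.tail x)) (Set.mem_univ (Fin.tail y)) hs ht hst)
    refine convexHull_min (fun x hx => ?_) h hp
    have := trilinear_le_piecewiseLinear r₀ r m n q q' q'' hm hn hq hq' hq''
      (u := Fin.tail x) hx.2
    rw [← heq] at this
    exact hx.1.le.trans this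
  mem u hu := by
    obtain ⟨b₀, b₁, b₂, t, h1, h2, h3, h4, h5, h6, h7, h8, h⟩ := hb u hu
    rw [h]
    exact cons_mem_cubeHull a u b₀ b₁ b₂ t h1 h2 h3 h4 h5 h6 h7 h8

/-- The envelope when it is linear along the diagonal of the cube from the origin to `(1, 1, 1)`.
An index with `1 ≤ a i` contributes the minimum of the other two coordinates, an index with `a i < 1`
contributes a corner. -/
theorem isUpperEnvelope_of_diagonal {a : Fin 3 → ℝ}
    (ha : max (1 - a 0) 0 + max (1 - a 1) 0 + max (1 - a 2) 0 ≤ 2) :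
    IsUpperEnvelope a (piecewiseLinear ((a 0 - 1) * (a 1 - 1) * (a 2 - 1))
      ![2 * ((a 1 - 1) * (a 2 - 1)), 2 * ((a 0 - 1) * (a 2 - 1)), 2 * ((a 0 - 1) * (a 1 - 1))]
      (fun i => 4 * max (a i - 1) 0)
      (4 * (2 - (max (1 - a 0) 0 + max (1 - a 1) 0 + max (1 - a 2) 0)))
      (fun i => 4 * max (1 - a i) 0) 0 0) := by
  have hdiff : ∀ i, max (a i - 1) 0 = max (1 - a i) 0 + (a i - 1) := fun i => by
    rcases le_total (a i) 1 with h | h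
    · rw [max_eq_right (by linarith), max_eq_left (by linarith)]; ring
    · rw [max_eq_left (by linarith), max_eq_right (by linarith)]; ring
  refine isUpperEnvelope_piecewiseLinear (fun i => by positivity) (by linarith)
    (fun i => by positivity) le_rfl le_rfl (fun u => ?_) fun u hu => ?_
  · simp only [hdiff, Matrix.cons_val]
    ring
  -- Whatever lies between the corner function and the minimum of the pair can serve as `b - t`.
  · have key : ∀ i, ∀ x y z : ℝ, x ∈ Set.Icc (0 : ℝ) 1 → y ∈ Set.Icc (0 : ℝ) 1 →
        z ∈ Set.Icc (0 : ℝ) 1 → ∃ d, max (y + z - x - 1) 0 ≤ d ∧ d ≤ min y z - min x (min y z) ∧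
          (a i - 1) * (d + min x (min y z)) = max (a i - 1) 0 * min y z
            - max (1 - a i) 0 * (min x (min y z) + max (y + z - x - 1) 0) := by
      intro i x y z hx hy hz
      have hle : max (y + z - x - 1) 0 ≤ min y z - min x (min y z) := by
        refine max_le ?_ (sub_nonneg.2 (min_le_right _ _))
        have : min x (min y z) ≤ x := min_le_left _ _
        rcases le_total y z with h | h
        · rw [min_eq_left h] at *
          linarith [hz.2]
        · rw [min_eq_right h] at *
          linarith [hy.2]
      rcases le_total (a i) 1 with h | h
      · refine ⟨_, le_rfl, hle, ?_⟩
        rw [max_eq_right (a := a i - 1) (by linarith), max_eq_left (a := 1 - a i) (by linarith)]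
        ring
      · refine ⟨_, hle, le_rfl, ?_⟩
        rw [max_eq_left (a := a i - 1) (by linarith), max_eq_right (a := 1 - a i) (by linarith)]
        ring
    obtain ⟨d₀, l₀, g₀, e₀⟩ := key 0 (u 0) (u 1) (u 2) (hu 0) (hu 1) (hu 2)
    obtain ⟨d₁, l₁, g₁, e₁⟩ := key 1 (u 1) (u 0) (u 2) (hu 1) (hu 0) (hu 2)
    obtain ⟨d₂, l₂, g₂, e₂⟩ := key 2 (u 2) (u 0) (u 1) (hu 2) (hu 0) (hu 1)
    rw [min_left_comm] at g₁ e₁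
    have hrot : min (u 2) (min (u 0) (u 1)) = min (u 0) (min (u 1) (u 2)) := by
      rw [min_comm, min_assoc]
    rw [hrot] at g₂ e₂
    refine ⟨d₀ + min (u 0) (min (u 1) (u 2)), d₁ + min (u 0) (min (u 1) (u 2)),
      d₂ + min (u 0) (min (u 1) (u 2)), min (u 0) (min (u 1) (u 2)),
      le_min (hu 0).1 (le_min (hu 1).1 (hu 2).1), ?_, ?_, ?_, ?_, ?_, ?_, ?_, ?_⟩
    · linarith [(le_max_right _ _).trans l₀]
    · linarith [(le_max_right _ _).trans l₁]
    · linarith [(le_max_right _ _).trans l₂]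
    · have : min (u 0) (u 2) + min (u 0) (u 1) - min (u 0) (min (u 1) (u 2)) ≤ u 0 := by
        rw [← min_assoc]
        rcases min_cases (min (u 0) (u 1)) (u 2) with h | h
        · linarith [min_le_left (u 0) (u 2)]
        · linarith [min_le_right (u 0) (u 2), min_le_left (u 0) (u 1)]
      linarith
    · have : min (u 1) (u 2) + min (u 0) (u 1) - min (u 0) (min (u 1) (u 2)) ≤ u 1 := by
        rcases min_cases (u 0) (min (u 1) (u 2)) with h | h
        · linarith [min_le_left (u 0) (u 1), min_le_left (u 1) (u 2)]
        · linarith [min_le_right (u 0) (u 1)]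
      linarith
    · have : min (u 1) (u 2) + min (u 0) (u 2) - min (u 0) (min (u 1) (u 2)) ≤ u 2 := by
        rcases min_cases (u 0) (min (u 1) (u 2)) with h | h
        · linarith [min_le_left (u 0) (u 2), min_le_right (u 1) (u 2)]
        · linarith [min_le_right (u 0) (u 2)]
      linarith
    -- If `u i` is the minimum, then the corner function with index `i` alone makes up for the rest.
    · have f₀ := (le_max_left _ _).trans l₀
      have f₁ := (le_max_left _ _).trans l₁
      have f₂ := (le_max_left _ _).trans l₂
      have f₀' := (le_max_right _ _).trans l₀
      have f₁' := (le_max_right _ _).trans l₁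
      have f₂' := (le_max_right _ _).trans l₂
      rcases min_cases (u 0) (min (u 1) (u 2)) with h | h
      · linarith
      · rcases min_cases (u 1) (u 2) with h' | h' <;> linarith
    · simp only [piecewiseLinear, Matrix.cons_val]
      linear_combination -4 * e₀ - 4 * e₁ - 4 * e₂

/-- The envelope when it is linear on the tetrahedron with vertices `(1, 1, 1)`, `(1, 0, 0)`,
`(0, 1, 0)` and `(0, 0, 1)` and on the four corners of the cube around it. -/
theorem isUpperEnvelope_of_tetrahedron {a : Fin 3 → ℝ} (h : a 0 + a 1 + a 2 ≤ 1)
    (h₀ : a 0 ≤ 1 + a 1 + a 2) (h₁ : a 1 ≤ 1 + a 0 + a 2) (h₂ : a 2 ≤ 1 + a 0 + a 1) :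
    IsUpperEnvelope a (piecewiseLinear
      ((a 0 - 1) * (a 1 - 1) * (a 2 - 1) + 2 * (1 - a 0 - a 1 - a 2))
      ![2 * ((a 1 - 1) * (a 2 - 1)) - 2 * (1 - a 0 - a 1 - a 2),
        2 * ((a 0 - 1) * (a 2 - 1)) - 2 * (1 - a 0 - a 1 - a 2),
        2 * ((a 0 - 1) * (a 1 - 1)) - 2 * (1 - a 0 - a 1 - a 2)]
      0 0
      ![2 * (1 + a 1 + a 2 - a 0), 2 * (1 + a 0 + a 2 - a 1), 2 * (1 + a 0 + a 1 - a 2)]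
      (2 * (1 - a 0 - a 1 - a 2)) 0) := by
  refine isUpperEnvelope_piecewiseLinear (fun i => le_rfl) le_rfl (fun i => ?_) (by linarith)
    le_rfl (fun u => ?_) fun u hu => ?_
  · fin_cases i <;> simp <;> linarith
  · simp only [Pi.zero_apply, Matrix.cons_val]
    ring
  -- The weights of the four vertices with corners are the corner functions.
  · obtain ⟨t, ht⟩ : ∃ t, 2 * t = max (1 - u 0 - u 1 - u 2) 0 - max (u 1 + u 2 - u 0 - 1) 0
        - max (u 0 + u 2 - u 1 - 1) 0 - max (u 0 + u 1 - u 2 - 1) 0 - 1 + u 0 + u 1 + u 2 :=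
      ⟨_, mul_div_cancel₀ _ two_ne_zero⟩
    have c₀ := hu 0
    have c₁ := hu 1
    have c₂ := hu 2
    simp only [Set.mem_Icc] at c₀ c₁ c₂
    refine ⟨t + max (u 1 + u 2 - u 0 - 1) 0, t + max (u 0 + u 2 - u 1 - 1) 0,
      t + max (u 0 + u 1 - u 2 - 1) 0, t, ?_, ?_, ?_, ?_, ?_, ?_, ?_, ?_, ?_⟩
    · rcases max_cases (1 - u 0 - u 1 - u 2) 0 with e | e <;>
      rcases max_cases (u 1 + u 2 - u 0 - 1) 0 with e₀ | e₀ <;>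
      rcases max_cases (u 0 + u 2 - u 1 - 1) 0 with e₁ | e₁ <;>
      rcases max_cases (u 0 + u 1 - u 2 - 1) 0 with e₂ | e₂ <;> linarith
    · linarith [le_max_right (u 1 + u 2 - u 0 - 1) 0]
    · linarith [le_max_right (u 0 + u 2 - u 1 - 1) 0]
    · linarith [le_max_right (u 0 + u 1 - u 2 - 1) 0]
    · rcases max_cases (1 - u 0 - u 1 - u 2) 0 with e | e <;>
      rcases max_cases (u 1 + u 2 - u 0 - 1) 0 with e₀ | e₀ <;>
      rcases max_cases (u 0 + u 2 - u 1 - 1) 0 with e₁ | e₁ <;>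
      rcases max_cases (u 0 + u 1 - u 2 - 1) 0 with e₂ | e₂ <;> linarith
    · rcases max_cases (1 - u 0 - u 1 - u 2) 0 with e | e <;>
      rcases max_cases (u 1 + u 2 - u 0 - 1) 0 with e₀ | e₀ <;>
      rcases max_cases (u 0 + u 2 - u 1 - 1) 0 with e₁ | e₁ <;>
      rcases max_cases (u 0 + u 1 - u 2 - 1) 0 with e₂ | e₂ <;> linarith
    · rcases max_cases (1 - u 0 - u 1 - u 2) 0 with e | e <;>
      rcases max_cases (u 1 + u 2 - u 0 - 1) 0 with e₀ | e₀ <;>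
      rcases max_cases (u 0 + u 2 - u 1 - 1) 0 with e₁ | e₁ <;>
      rcases max_cases (u 0 + u 1 - u 2 - 1) 0 with e₂ | e₂ <;> linarith
    · linarith [le_max_right (1 - u 0 - u 1 - u 2) 0]
    · simp only [piecewiseLinear, Pi.zero_apply, Matrix.cons_val]
      linear_combination (2 - 2 * (a 0 + a 1 + a 2)) * ht

/-- The envelope when it is linear on the corners of the cube at `(1, 0, 0)` and `(0, 1, 1)` and
along the diagonal from the origin to `(1, 1, 1)`. -/
theorem isUpperEnvelope_of_opposite_corners {a : Fin 3 → ℝ} (h₀ : a 0 ≤ -1) (h₁ : 0 ≤ a 0 + a 1)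
    (h₂ : 0 ≤ a 0 + a 2) :
    IsUpperEnvelope a (piecewiseLinear ((a 0 - 1) * (a 1 - 1) * (a 2 - 1))
      ![2 * ((a 1 - 1) * (a 2 - 1)) + 4 * (-1 - a 0), 2 * ((a 0 - 1) * (a 2 - 1)),
        2 * ((a 0 - 1) * (a 1 - 1))]
      ![0, 4 * (a 0 + a 1), 4 * (a 0 + a 2)] 0 ![4 * (1 - a 0), 0, 0] 0 (4 * (-1 - a 0))) := by
  refine isUpperEnvelope_piecewiseLinear (fun i => ?_) le_rfl (fun i => ?_) le_rfl (by linarith)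
    (fun u => ?_) fun u hu => ?_
  · fin_cases i <;> simp <;> linarith
  · fin_cases i <;> simp; linarith
  · simp only [Matrix.cons_val]
    ring
  · have c₀ := hu 0
    have c₁ := hu 1
    have c₂ := hu 2
    simp only [Set.mem_Icc] at c₀ c₁ c₂
    obtain ⟨t, ht⟩ : ∃ t, t = max (u 0 - u 1 - u 2) 0 - u 0 + min (u 0) (u 1) + min (u 0) (u 2) :=
      ⟨_, rfl⟩
    refine ⟨t + max (u 1 + u 2 - u 0 - 1) 0, min (u 0) (u 2), min (u 0) (u 1), t,
      ?_, ?_, ?_, ?_, ?_, ?_, ?_, ?_, ?_⟩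
    · rcases max_cases (u 0 - u 1 - u 2) 0 with e | e <;>
      rcases min_cases (u 0) (u 1) with e₁ | e₁ <;>
      rcases min_cases (u 0) (u 2) with e₂ | e₂ <;> linarith
    · linarith [le_max_right (u 1 + u 2 - u 0 - 1) 0]
    · rcases max_cases (u 0 - u 1 - u 2) 0 with e | e <;>
      rcases min_cases (u 0) (u 1) with e₁ | e₁ <;>
      rcases min_cases (u 0) (u 2) with e₂ | e₂ <;> linarith
    · rcases max_cases (u 0 - u 1 - u 2) 0 with e | e <;>
      rcases min_cases (u 0) (u 1) with e₁ | e₁ <;>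
      rcases min_cases (u 0) (u 2) with e₂ | e₂ <;> linarith
    · linarith [le_max_right (u 0 - u 1 - u 2) 0]
    · rcases max_cases (u 1 + u 2 - u 0 - 1) 0 with e | e <;>
      rcases min_cases (u 0) (u 1) with e₁ | e₁ <;>
      rcases min_cases (u 0) (u 2) with e₂ | e₂ <;> linarith
    · rcases max_cases (u 1 + u 2 - u 0 - 1) 0 with e | e <;>
      rcases min_cases (u 0) (u 1) with e₁ | e₁ <;>
      rcases min_cases (u 0) (u 2) with e₂ | e₂ <;> linarith
    · rcases max_cases (u 1 + u 2 - u 0 - 1) 0 with e | e <;>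
      rcases min_cases (u 0) (u 1) with e₁ | e₁ <;>
      rcases min_cases (u 0) (u 2) with e₂ | e₂ <;> linarith
    · simp only [piecewiseLinear, Matrix.cons_val]
      linear_combination (-(4 * a 0) - 4) * ht

/-! ### The volume between the two envelopes -/

open scoped Pointwise in
theorem convexHull_vadd_image (v d : Fin 4 → ℝ) {S S' : Set (Fin 4 → ℝ)}
    (h : S' = v +ᵥ Matrix.toLin' (Matrix.diagonal d) '' S) :
    convexHull ℝ S' = v +ᵥ Matrix.toLin' (Matrix.diagonal d) '' convexHull ℝ S := by
  rw [h, convexHull_vadd, LinearMap.image_convexHull]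

/-- The substitution `u 0 ↦ 1 - u 0` changes the sign of the trilinear function and of `a 0`. -/
theorem reflect_mem_cubeHull {a b : Fin 3 → ℝ} (h₀ : b 0 = -a 0) (h₁ : b 1 = a 1) (h₂ : b 2 = a 2)
    {t : ℝ} {u : Fin 3 → ℝ} (h : (Fin.cons t u : Fin 4 → ℝ) ∈ cubeHull a) :
    (Fin.cons (-t) ![1 - u 0, u 1, u 2] : Fin 4 → ℝ) ∈ cubeHull b := by
  let f : (Fin 4 → ℝ) →ᵃ[ℝ] (Fin 4 → ℝ) :=
    (Matrix.toLin' (Matrix.diagonal ![-1, -1, 1, 1])).toAffineMap + AffineMap.const ℝ _ ![0, 1, 0, 0]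
  have hf : ∀ p, f p = ![-p 0, 1 - p 1, p 2, p 3] := by
    intro p
    ext i
    fin_cases i <;> simp [f, Matrix.mulVec_diagonal]
    ring
  have hsub : f '' cubeGraph a ⊆ cubeGraph b := by
    rintro _ ⟨p, ⟨hp, hI⟩, rfl⟩
    have i0 := hI 0
    have i1 := hI 1
    have i2 := hI 2
    simp only [Fin.succ_zero_eq_one, Fin.succ_one_eq_two, Set.mem_Icc] at i0 i1
    rw [hf]
    refine ⟨?_, fun i => ?_⟩
    · simp only [Matrix.cons_val, hp, h₀, h₁, h₂]
      ring
    · fin_cases i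
      · exact ⟨sub_nonneg.2 i0.2, sub_le_self _ i0.1⟩
      · exact i1
      · exact i2
  have := convexHull_mono (𝕜 := ℝ) hsub
  rw [← AffineMap.image_convexHull] at this
  have h' := this (Set.mem_image_of_mem f h)
  rw [hf] at h'
  exact h'

theorem mem_cubeHull_iff {a b : Fin 3 → ℝ} (h₀ : b 0 = -a 0) (h₁ : b 1 = a 1) (h₂ : b 2 = a 2)
    {U V : (Fin 3 → ℝ) → ℝ} (hU : IsUpperEnvelope a U) (hV : IsUpperEnvelope b V)
    {t : ℝ} {u : Fin 3 → ℝ} :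
    (Fin.cons t u : Fin 4 → ℝ) ∈ cubeHull a ↔
      u ∈ Set.Icc 0 1 ∧ t ∈ Set.Icc (-V ![1 - u 0, u 1, u 2]) (U u) := by
  constructor
  · intro h
    have hu := tail_mem_Icc_of_mem_cubeHull h
    refine ⟨⟨fun i => (hu i).1, fun i => (hu i).2⟩, ?_, hU.le _ h⟩
    exact neg_le.1 (hV.le _ (reflect_mem_cubeHull h₀ h₁ h₂ h))
  · rintro ⟨hu, ht⟩
    have hu' : ∀ i, u i ∈ Set.Icc (0 : ℝ) 1 := fun i => ⟨hu.1 i, hu.2 i⟩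
    have hr : ∀ i, (![1 - u 0, u 1, u 2] : Fin 3 → ℝ) i ∈ Set.Icc (0 : ℝ) 1 := by
      intro i
      fin_cases i
      · exact ⟨sub_nonneg.2 (hu' 0).2, sub_le_self _ (hu' 0).1⟩
      · exact hu' 1
      · exact hu' 2
    have hlow := reflect_mem_cubeHull (b := a) (by rw [h₀, neg_neg]) h₁.symm h₂.symm (hV.mem _ hr)
    have hrr : (![1 - (![1 - u 0, u 1, u 2] : Fin 3 → ℝ) 0, (![1 - u 0, u 1, u 2] : Fin 3 → ℝ) 1,
        (![1 - u 0, u 1, u 2] : Fin 3 → ℝ) 2] : Fin 3 → ℝ) = u := by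
      ext i
      fin_cases i <;> simp
    rw [hrr] at hlow
    -- The fibre of the hull over `u` is convex.
    obtain ⟨s, s', hs, hs', hss, rfl⟩ := (segment_eq_Icc (ht.1.trans ht.2)).symm ▸ ht
    have hmem := convex_convexHull ℝ (cubeGraph a) hlow (hU.mem u hu') hs hs' hss
    change _ ∈ cubeHull a at hmem
    convert hmem using 1
    ext i
    refine Fin.cases ?_ (fun i => ?_) i
    · simp
    · simp only [Fin.cons_succ, Pi.add_apply, Pi.smul_apply, smul_eq_mul]
      rw [← add_mul, hss, one_mul]

theorem integral_cube_reflect (F : (Fin 3 → ℝ) → ℝ) (hF : Continuous F) :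
    ∫ u in Set.Icc (0 : Fin 3 → ℝ) 1, F ![1 - u 0, u 1, u 2] =
      ∫ u in Set.Icc (0 : Fin 3 → ℝ) 1, F u := by
  have hc : Continuous fun u : Fin 3 → ℝ => F ![1 - u 0, u 1, u 2] := by
    refine hF.comp (continuous_pi fun i => ?_)
    fin_cases i
    exacts [continuous_const.sub (continuous_apply 0), continuous_apply 1, continuous_apply 2]
  rw [integral_cube_eq_iterated _ hc, integral_cube_eq_iterated _ hF]
  exact integral_zero_one_comp_one_sub fun x =>
    ∫ y in (0 : ℝ)..1, ∫ z in (0 : ℝ)..1, F ![x, y, z]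

theorem volume_cubeHull {a b : Fin 3 → ℝ} (h₀ : b 0 = -a 0) (h₁ : b 1 = a 1) (h₂ : b 2 = a 2)
    {U V : (Fin 3 → ℝ) → ℝ} (hU : IsUpperEnvelope a U) (hV : IsUpperEnvelope b V) :
    volume (cubeHull a) = ENNReal.ofReal
      ((∫ u in Set.Icc (0 : Fin 3 → ℝ) 1, U u) + ∫ u in Set.Icc (0 : Fin 3 → ℝ) 1, V u) := by
  have hcU := hU.continuous
  have hcV : Continuous fun u : Fin 3 → ℝ => V ![1 - u 0, u 1, u 2] := by
    refine hV.continuous.comp (continuous_pi fun i => ?_)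
    fin_cases i
    exacts [continuous_const.sub (continuous_apply 0), continuous_apply 1, continuous_apply 2]
  let R : Set (ℝ × (Fin 3 → ℝ)) :=
    {x | x.2 ∈ Set.Icc 0 1 ∧ x.1 ∈ Set.Icc (-V ![1 - x.2 0, x.2 1, x.2 2]) (U x.2)}
  have hR : MeasurableSet R := by
    refine IsClosed.measurableSet (.inter (isClosed_Icc.preimage continuous_snd)
      (.inter (isClosed_le ?_ continuous_fst) (isClosed_le continuous_fst ?_)))
    · exact (hcV.comp continuous_snd).neg
    · exact hcU.comp continuous_snd
  have hpre : cubeHull a = MeasurableEquiv.piFinSuccAbove (fun _ : Fin 4 => ℝ) 0 ⁻¹' R := by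
    ext p
    rw [← Fin.cons_self_tail p]
    exact mem_cubeHull_iff h₀ h₁ h₂ hU hV
  have hint : IntegrableOn (fun u : Fin 3 → ℝ => U u + V ![1 - u 0, u 1, u 2]) (Set.Icc 0 1) :=
    (hcU.add hcV).continuousOn.integrableOn_compact isCompact_Icc
  rw [hpre, (volume_preserving_piFinSuccAbove (fun _ : Fin 4 => ℝ) 0).measure_preimage
    hR.nullMeasurableSet, Measure.volume_eq_prod, Measure.prod_apply_symm hR,
    ← integral_cube_reflect V hV.continuous, ← integral_add
      (hcU.continuousOn.integrableOn_compact isCompact_Icc)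
      (hcV.continuousOn.integrableOn_compact isCompact_Icc),
    ofReal_integral_eq_lintegral_ofReal hint,
    ← lintegral_indicator measurableSet_Icc]
  · refine lintegral_congr fun u => ?_
    by_cases hu : u ∈ Set.Icc (0 : Fin 3 → ℝ) 1
    · have : (fun t => (t, u)) ⁻¹' R = Set.Icc (-V ![1 - u 0, u 1, u 2]) (U u) := by
        ext t
        exact and_iff_right hu
      rw [this, Set.indicator_of_mem hu, Real.volume_Icc, sub_neg_eq_add]
    · have : (fun t => (t, u)) ⁻¹' R = ∅ := by
        ext t
        exact iff_of_false (fun h => hu h.1) id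
      rw [this, Set.indicator_of_notMem hu, measure_empty]
  · refine (ae_restrict_iff' measurableSet_Icc).2 (.of_forall fun u hu => ?_)
    have h := ((mem_cubeHull_iff h₀ h₁ h₂ hU hV).1 (hU.mem u fun i => ⟨hu.1 i, hu.2 i⟩)).2.1
    simp only [Pi.zero_apply]
    linarith

open scoped Pointwise in
theorem volume_trilinearHull {c ℓ : Fin 3 → ℝ} (hℓ : ∀ i, 0 < ℓ i) :
    volume (trilinearHull c ℓ) =
      ENNReal.ofReal (8 * ℓ 0 ^ 2 * ℓ 1 ^ 2 * ℓ 2 ^ 2) * volume (cubeHull fun i => c i / ℓ i) := by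
  let v : Fin 4 → ℝ := Fin.cons 0 fun i => c i - ℓ i
  let d : Fin 4 → ℝ := Fin.cons (ℓ 0 * ℓ 1 * ℓ 2) fun i => 2 * ℓ i
  have h0 := (hℓ 0).ne'
  have h1 := (hℓ 1).ne'
  have h2 := (hℓ 2).ne'
  have himg : trilinearGraph c ℓ =
      v +ᵥ Matrix.toLin' (Matrix.diagonal d) '' cubeGraph fun i => c i / ℓ i := by
    ext q
    simp only [Set.mem_vadd_set, Set.mem_image, exists_exists_and_eq_and]
    constructor
    · rintro ⟨hq, hI⟩
      refine ⟨Fin.cons (q 0 / (ℓ 0 * ℓ 1 * ℓ 2)) fun i => (q i.succ - (c i - ℓ i)) / (2 * ℓ i),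
        ⟨?_, fun i => ?_⟩, ?_⟩
      · change q 0 / (ℓ 0 * ℓ 1 * ℓ 2) = (c 0 / ℓ 0 - 1 + 2 * ((q 1 - (c 0 - ℓ 0)) / (2 * ℓ 0))) *
          (c 1 / ℓ 1 - 1 + 2 * ((q 2 - (c 1 - ℓ 1)) / (2 * ℓ 1))) *
          (c 2 / ℓ 2 - 1 + 2 * ((q 3 - (c 2 - ℓ 2)) / (2 * ℓ 2)))
        rw [hq]
        field_simp
        ring
      · have := hI i
        have hi := hℓ i
        rw [Fin.cons_succ, Set.mem_Icc, le_div_iff₀ (by positivity), div_le_iff₀ (by positivity)]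
        constructor <;> linarith [this.1, this.2]
      · ext i
        refine Fin.cases ?_ (fun i => ?_) i
        · simp [v, d, Matrix.mulVec_diagonal]
          field_simp
        · have := (hℓ i).ne'
          simp [v, d, Matrix.mulVec_diagonal]
          field_simp
          ring
    · rintro ⟨p, ⟨hp, hI⟩, rfl⟩
      have hval : ∀ i : Fin 3, (v +ᵥ Matrix.toLin' (Matrix.diagonal d) p) i.succ =
          c i - ℓ i + 2 * ℓ i * p i.succ := by
        intro i
        simp [v, d, Matrix.mulVec_diagonal]
      refine ⟨?_, fun i => ?_⟩
      · have e0 := hval 0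
        have e1 := hval 1
        have e2 := hval 2
        simp only [Fin.succ_zero_eq_one, Fin.succ_one_eq_two, show (2 : Fin 3).succ = 3 from rfl]
          at e0 e1 e2
        rw [e0, e1, e2]
        simp only [vadd_eq_add, Pi.add_apply, Matrix.toLin'_apply, Matrix.mulVec_diagonal, v, d,
          Fin.cons_zero, hp]
        field_simp
        ring
      · have := hI i
        have hi := hℓ i
        rw [hval]
        constructor <;> nlinarith [this.1, this.2]
  unfold trilinearHull cubeHull
  rw [convexHull_vadd_image v d himg, measure_vadd, Measure.addHaar_image_linearMap,
    LinearMap.det_toLin', Matrix.det_diagonal]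
  congr 2
  simp only [d, Fin.prod_univ_four]
  change |ℓ 0 * ℓ 1 * ℓ 2 * (2 * ℓ 0) * (2 * ℓ 1) * (2 * ℓ 2)| = _
  have := hℓ 0
  have := hℓ 1
  have := hℓ 2
  rw [abs_of_pos (by positivity)]
  ring

/-! ### The six cases -/

/-- The volume formulas in terms of the ratios `a i = c i / ℓ i` alone. -/
theorem volume_cubeHull_eq {a : Fin 3 → ℝ} (h₀ : 0 ≤ a 0) (h₀₁ : a 0 ≤ a 1) (h₁₂ : a 1 ≤ a 2)
    (k : Fin 6) (hk : caseCondition a 1 k) :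
    volume (cubeHull a) = ENNReal.ofReal (caseVolume a 1 k / 8) := by
  let b : Fin 3 → ℝ := ![-a 0, a 1, a 2]
  have hb₀ : b 0 = -a 0 := rfl
  have hb₁ : b 1 = a 1 := rfl
  have hb₂ : b 2 = a 2 := rfl
  have p : ∀ x : ℝ, 0 ≤ x → max x 0 = x := fun x hx => max_eq_left hx
  have z : ∀ x : ℝ, x ≤ 0 → max x 0 = 0 := fun x hx => max_eq_right hx
  fin_cases k <;>
    simp only [caseCondition, caseVolume, Fin.zero_eta, Fin.mk_one, Fin.reduceFinMk,
      Matrix.cons_val, Pi.one_apply, div_one] at hk ⊢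
  · have p₀ := p (a 0 - 1) (by linarith)
    have p₁ := p (a 1 - 1) (by linarith)
    have p₂ := p (a 2 - 1) (by linarith)
    have z₀ := z (1 - a 0) (by linarith)
    have z₁ := z (1 - a 1) (by linarith)
    have z₂ := z (1 - a 2) (by linarith)
    have hU := isUpperEnvelope_of_diagonal (a := a) (by linarith)
    have hV := isUpperEnvelope_of_opposite_corners (a := b) (by linarith) (by linarith)
      (by linarith)
    rw [volume_cubeHull hb₀ hb₁ hb₂ hU hV, integral_piecewiseLinear, integral_piecewiseLinear]
    simp only [hb₀, hb₁, hb₂, p₀, p₁, p₂, z₀, z₁, z₂, Matrix.cons_val]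
    congr 1; ring
  · have p₀ := p (1 - a 0) (by linarith)
    have p₀' := p (1 - -a 0) (by linarith)
    have p₁ := p (a 1 - 1) (by linarith)
    have p₂ := p (a 2 - 1) (by linarith)
    have z₀ := z (a 0 - 1) (by linarith)
    have z₀' := z (-a 0 - 1) (by linarith)
    have z₁ := z (1 - a 1) (by linarith)
    have z₂ := z (1 - a 2) (by linarith)
    have hU := isUpperEnvelope_of_diagonal (a := a) (by linarith)
    have hV := isUpperEnvelope_of_diagonal (a := b) (by rw [hb₀, hb₁, hb₂]; linarith)
    rw [volume_cubeHull hb₀ hb₁ hb₂ hU hV, integral_piecewiseLinear, integral_piecewiseLinear]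
    simp only [hb₀, hb₁, hb₂, p₀, p₀', p₁, p₂, z₀, z₀', z₁, z₂, Matrix.cons_val]
    congr 1; ring
  · have p₀ := p (1 - a 0) (by linarith)
    have p₀' := p (1 - -a 0) (by linarith)
    have p₁ := p (1 - a 1) (by linarith)
    have p₂ := p (a 2 - 1) (by linarith)
    have z₀ := z (a 0 - 1) (by linarith)
    have z₀' := z (-a 0 - 1) (by linarith)
    have z₁ := z (a 1 - 1) (by linarith)
    have z₂ := z (1 - a 2) (by linarith)
    have hU := isUpperEnvelope_of_diagonal (a := a) (by linarith)
    have hV := isUpperEnvelope_of_diagonal (a := b) (by rw [hb₀, hb₁, hb₂]; linarith)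
    rw [volume_cubeHull hb₀ hb₁ hb₂ hU hV, integral_piecewiseLinear, integral_piecewiseLinear]
    simp only [hb₀, hb₁, hb₂, p₀, p₀', p₁, p₂, z₀, z₀', z₁, z₂, Matrix.cons_val]
    congr 1; ring
  · have p₀ := p (1 - a 0) (by linarith)
    have p₀' := p (1 - -a 0) (by linarith)
    have p₁ := p (1 - a 1) (by linarith)
    have p₂ := p (1 - a 2) (by linarith)
    have z₀ := z (a 0 - 1) (by linarith)
    have z₀' := z (-a 0 - 1) (by linarith)
    have z₁ := z (a 1 - 1) (by linarith)
    have z₂ := z (a 2 - 1) (by linarith)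
    have hU := isUpperEnvelope_of_diagonal (a := a) (by linarith)
    have hV := isUpperEnvelope_of_diagonal (a := b) (by rw [hb₀, hb₁, hb₂]; linarith)
    rw [volume_cubeHull hb₀ hb₁ hb₂ hU hV, integral_piecewiseLinear, integral_piecewiseLinear]
    simp only [hb₀, hb₁, hb₂, p₀, p₀', p₁, p₂, z₀, z₀', z₁, z₂, Matrix.cons_val]
    congr 1; ring
  · have p₀ := p (1 - a 0) (by linarith)
    have p₁ := p (1 - a 1) (by linarith)
    have p₂ := p (1 - a 2) (by linarith)
    have z₀ := z (a 0 - 1) (by linarith)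
    have z₁ := z (a 1 - 1) (by linarith)
    have z₂ := z (a 2 - 1) (by linarith)
    have hU := isUpperEnvelope_of_diagonal (a := a) (by linarith)
    have hV := isUpperEnvelope_of_tetrahedron (a := b) (by linarith) (by linarith) (by linarith)
      (by linarith)
    rw [volume_cubeHull hb₀ hb₁ hb₂ hU hV, integral_piecewiseLinear, integral_piecewiseLinear]
    simp only [hb₀, hb₁, hb₂, p₀, p₁, p₂, z₀, z₁, z₂, Matrix.cons_val, Pi.zero_apply]
    congr 1; ring
  · have hU := isUpperEnvelope_of_tetrahedron (a := a) (by linarith) (by linarith) (by linarith)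
      (by linarith)
    have hV := isUpperEnvelope_of_tetrahedron (a := b) (by linarith) (by linarith) (by linarith)
      (by linarith)
    rw [volume_cubeHull hb₀ hb₁ hb₂ hU hV, integral_piecewiseLinear, integral_piecewiseLinear]
    simp only [hb₀, hb₁, hb₂, Matrix.cons_val, Pi.zero_apply]
    congr 1; ring

theorem caseCondition_div (c ℓ : Fin 3 → ℝ) :
    caseCondition (fun i => c i / ℓ i) 1 = caseCondition c ℓ := by
  simp only [caseCondition, Pi.one_apply, div_one]

theorem caseVolume_eq_mul (c ℓ : Fin 3 → ℝ) (k : Fin 6) :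
    caseVolume c ℓ k = 8 * ℓ 0 ^ 2 * ℓ 1 ^ 2 * ℓ 2 ^ 2 *
      (caseVolume (fun i => c i / ℓ i) 1 k / 8) := by
  fin_cases k <;> simp only [caseVolume, Fin.zero_eta, Fin.mk_one, Fin.reduceFinMk,
      Matrix.cons_val, Pi.one_apply, div_one] <;> ring

theorem caseRegion_nonempty (k : Fin 6) : (caseRegion k).Nonempty := by
  have key : ∀ x y z : ℝ, 0 ≤ x → x ≤ y → y ≤ z → caseCondition ![x, y, z] 1 k →
      (caseRegion k).Nonempty := by
    refine fun x y z h₀ h₁ h₂ h => ⟨(![x, y, z], 1), ⟨fun i => ?_, fun _ => one_pos, ?_, ?_⟩, h⟩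
    · fin_cases i
      exacts [h₀, h₀.trans h₁, (h₀.trans h₁).trans h₂]
    · simpa using h₁
    · simpa using h₂
  simp only [caseCondition, Matrix.cons_val, Pi.one_apply, div_one] at key
  fin_cases k
  · apply key 1 1 1 <;> norm_num
  · apply key 0 1 1 <;> norm_num
  · apply key 0 0 1 <;> norm_num
  · apply key 0 (1 / 2) (1 / 2) <;> norm_num
  · apply key (1 / 2) (1 / 2) (1 / 2) <;> norm_num
  · apply key 0 0 0 <;> norm_num

theorem disjoint_caseRegion {j k : Fin 6} (hjk : j ≠ k) :
    Disjoint (caseRegion j) (caseRegion k) := by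
  wlog hlt : j < k generalizing j k
  · exact (this hjk.symm (hjk.symm.lt_of_le (not_lt.1 hlt))).symm
  rw [Set.disjoint_left]
  rintro p ⟨⟨-, -, h₁, h₂⟩, hj⟩ ⟨-, hk⟩
  fin_cases j <;> fin_cases k <;>
    first
    | exact absurd hlt (by decide)
    | simp only [caseCondition, Fin.zero_eta, Fin.mk_one, Fin.reduceFinMk, Matrix.cons_val]
        at hj hk
      linarith

theorem iUnion_caseRegion : ⋃ k : Fin 6, caseRegion k = parameterSpace := by
  refine Set.Subset.antisymm (Set.iUnion_subset fun k p hp => hp.1) fun p hp => ?_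
  suffices h : ∃ k, caseCondition p.1 p.2 k by
    obtain ⟨k, hk⟩ := h
    exact Set.mem_iUnion.2 ⟨k, hp, hk⟩
  rcases le_or_gt 1 (p.1 0 / p.2 0) with h₀ | h₀
  · exact ⟨0, h₀⟩
  rcases le_or_gt 1 (p.1 1 / p.2 1) with h₁ | h₁
  · exact ⟨1, h₀, h₁⟩
  rcases le_or_gt 1 (p.1 2 / p.2 2) with h₂ | h₂
  · exact ⟨2, h₁, h₂⟩
  rcases lt_or_ge (p.1 0 / p.2 0 + p.1 1 / p.2 1 + p.1 2 / p.2 2) 1 with h₃ | h₃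
  · exact ⟨5, h₂, h₃⟩
  rcases le_or_gt (1 + p.1 0 / p.2 0) (p.1 1 / p.2 1 + p.1 2 / p.2 2) with h₄ | h₄
  · exact ⟨3, h₂, h₃, h₄⟩
  · exact ⟨4, h₂, h₃, h₄⟩

theorem theorem6 :
    (∀ c ℓ : Fin 3 → ℝ, (∀ i, 0 ≤ c i) → (∀ i, 0 < ℓ i) →
      c 0 / ℓ 0 ≤ c 1 / ℓ 1 → c 1 / ℓ 1 ≤ c 2 / ℓ 2 →
      ∀ k : Fin 6, caseCondition c ℓ k →
        volume (trilinearHull c ℓ) = ENNReal.ofReal (caseVolume c ℓ k)) ∧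
    (∀ k : Fin 6, (caseRegion k).Nonempty) ∧
    (∀ j k : Fin 6, j ≠ k → Disjoint (caseRegion j) (caseRegion k)) ∧
    (⋃ k : Fin 6, caseRegion k) = parameterSpace := by
  refine ⟨fun c ℓ hc hℓ h₀₁ h₁₂ k hk => ?_, caseRegion_nonempty,
    fun j k => disjoint_caseRegion, iUnion_caseRegion⟩
  rw [volume_trilinearHull hℓ, volume_cubeHull_eq (div_nonneg (hc 0) (hℓ 0).le) h₀₁ h₁₂ k
    (by rwa [caseCondition_div]), ← ENNReal.ofReal_mul (by positivity), ← caseVolume_eq_mul]
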